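/- Let $p\ge 1$ and $d\ge 0$ be integers, and let $G$ be a finite simple graph with vertex set $V$. A framework $(G,r)$ in dimension $m$ is a map $r:V\to\mathbb{R}^m$, where $\mathbb{R}^m$ carries the $l_p$ norm. It is $d$-flattenable if there is $s:V\to\mathbb{R}^d$ with $\|s(v)-s(w)\|_p=\|r(v)-r(w)\|_p$ for all edges $vw$ of $G$; the graph $G$ is $d$-flattenable (under $l_p$) if every framework $(G,r)$, in every finite dimension $m$, is $d$-flattenable. Let $\Phi\subseteq\mathbb{R}^{\binom V2}$ be the cone of all pairwise distance vectors $\delta_r=(\|r(v)-r(w)\|_p^p)_{\{v,w\}}$ of maps $r:V\to\mathbb{R}^m$, $m$ arbitrary. A framework $(G,r)$ is generic with respect to $d$-flattenability if there is an open neighborhood $\Omega$ of $\delta_r$ contained in the interior of $\Phi$ such that $(G,r)$ is $d$-flattenable if and only if all frameworks $(G,r')$ (in any dimension) with $\delta_{r'}\in\Omega$ are. A framework $(G,s)$ in dimension $d$ is well-positioned if the $l_p$ norm is differentiable at $s(v)-s(w)$ for every edge $vw$. Its $l_p$ rigidity matrix has one row per edge and $d$ columns per vertex; the row of the edge $vw$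 has the entries $\operatorname{sgn}(x_k)|x_k|^{p-1}$, $x=s(v)-s(w)$, in the columns of $v$, their negatives in the columns of $w$, and $0$ elsewhere. A well-positioned framework is regular if its rigidity matrix has maximal rank among all well-positioned frameworks of $G$ in dimension $d$. The graph $G$ is independent in the generic $d$-dimensional $l_p$ rigidity matroid if the rigidity matrix of a well-positioned and regular framework of $G$ in dimension $d$ has linearly independent rows. **Theorem.** There exists a framework $(G,r)$, in some finite dimension, that is generic with respect to $d$-flattenability and $d$-flattenable if and only if $G$ is independent in the generic $d$-dimensional $l_p$ rigidity matroid. Moreover, if $G$ is $d$-flattenable under the $l_p$ norm, then $G$ is independent in the generic $d$-dimensional $l_p$ rigidity matroid. -/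

import Mathlib

open scoped ENNReal

noncomputable section

namespace LpFlattening

variable {V : Type*}

/-- The space `ℝ^m` with the norm `‖x‖ = (∑ |x k| ^ p) ^ (1 / p)` (used for integers `p ≥ 1`). -/
abbrev LpSpace (p m : ℕ) : Type := PiLp (p : ℝ≥0∞) (fun _ : Fin m => ℝ)

/-- The `l_p^p` length vector, indexed by the edges of the graph `H`: its entry at `vw` is
`‖r v - r w‖ ^ p = ∑ |r v k - r w k| ^ p`.
For the complete graph `H = ⊤` it is the pairwise distance vector of the points `r v`. -/
def lengthVector {p m : ℕ} (H : SimpleGraph V) (r : V → LpSpace p m) : H.edgeSet → ℝ :=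
  fun e => Sym2.lift ⟨fun v w => ∑ k, |r v k - r w k| ^ p, fun v w => by
    simp only [abs_sub_comm]⟩ e.1

/-- The cone of all pairwise `l_p^p` distance vectors of configurations of points indexed by `V`
in `l_p` spaces of arbitrary finite dimension. -/
def cone (V : Type*) (p : ℕ) : Set ((⊤ : SimpleGraph V).edgeSet → ℝ) :=
  {δ | ∃ (m : ℕ) (r : V → LpSpace p m), lengthVector ⊤ r = δ}

/-- The framework `(G, r)` is `d`-flattenable: its edge lengths are realized in dimension `d`. -/
def IsFlattenableFramework {p m : ℕ} (d : ℕ) (G : SimpleGraph V) (r : V → LpSpace p m) : Prop :=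
  ∃ s : V → LpSpace p d, ∀ v w, G.Adj v w → ‖s v - s w‖ = ‖r v - r w‖

/-- The graph `G` is `d`-flattenable under the `l_p` norm: all its frameworks are. -/
def IsFlattenable (p d : ℕ) (G : SimpleGraph V) : Prop :=
  ∀ (m : ℕ) (r : V → LpSpace p m), IsFlattenableFramework d G r

/-- The framework `(G, r)`, in arbitrary dimension, is generic with respect to
`d`-flattenability. -/
def IsGeneric {p m : ℕ} (d : ℕ) (G : SimpleGraph V) (r : V → LpSpace p m) : Prop :=
  ∃ Ω : Set ((⊤ : SimpleGraph V).edgeSet → ℝ),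
    IsOpen Ω ∧ lengthVector ⊤ r ∈ Ω ∧ Ω ⊆ interior (cone V p) ∧
    (IsFlattenableFramework d G r ↔
      ∀ (m' : ℕ) (r' : V → LpSpace p m'), lengthVector ⊤ r' ∈ Ω → IsFlattenableFramework d G r')

/-- The framework `(G, s)` is well-positioned: the norm is differentiable at all edge vectors.
For `p = 1` this says that every edge vector lies in the open cone over a facet of the unit ball. -/
def IsWellPositioned {p d : ℕ} (G : SimpleGraph V) (s : V → LpSpace p d) : Prop :=
  ∀ v w, G.Adj v w → DifferentiableAt ℝ (fun x : LpSpace p d => ‖x‖) (s v - s w)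

open Classical in
/-- The `l_p` rigidity matrix of `(G, s)`. In the row of an edge `vw`, the `d` columns of `v` hold
the vector `(sign x_k * |x_k| ^ (p - 1))_k` with `x = s v - s w`, those of `w` hold its negative
(the same formula for `x = s w - s v`), and all other entries are `0`.
For `p = 2` the entries are `s v - s w`, for `p = 1` the functional of the facet containing
`x / ‖x‖`; at a well-positioned framework the row is, up to the factor `p`, the gradient of
`‖s v - s w‖ ^ p` with respect to `s`. -/
def rigidityMatrix {p d : ℕ} (G : SimpleGraph V) (s : V → LpSpace p d) :
    Matrix G.edgeSet (V × Fin d) ℝ :=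
  fun e c =>
    if h : c.1 ∈ e.1 then
      Real.sign (s c.1 c.2 - s (Sym2.Mem.other h) c.2) *
        |s c.1 c.2 - s (Sym2.Mem.other h) c.2| ^ (p - 1)
    else 0

/-- The framework `(G, s)` is well-positioned and regular: its rigidity matrix has the maximal rank
among all well-positioned frameworks of `G` in dimension `d`. -/
def IsRegular [Fintype V] {p d : ℕ} (G : SimpleGraph V) (s : V → LpSpace p d) : Prop :=
  IsWellPositioned G s ∧
    ∀ t : V → LpSpace p d, IsWellPositioned G t →
      (rigidityMatrix G t).rank ≤ (rigidityMatrix G s).rank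

/-- `G` is independent in the generic `d`-dimensional `l_p` rigidity matroid: the rows of the
rigidity matrix of a well-positioned and regular framework of `G` in dimension `d` are linearly
independent. (All regular frameworks have the same rank, so the choice is immaterial.) -/
def IsIndependent [Fintype V] (p d : ℕ) (G : SimpleGraph V) : Prop :=
  ∃ s : V → LpSpace p d, IsRegular G s ∧ LinearIndependent ℝ (rigidityMatrix G s).row

end LpFlattening

end

/-! By `isFlattenableFramework_iff`, flattenability means that the `l_p^p` edge length vector lies
in the image `L` of the length map on configurations in `ℝ^d`. Both directions say that independence
amounts to `L` having nonempty interior.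

If the rows at a well-positioned `s` are independent, the length map has a surjective derivative at
`s`, namely `p` times the rigidity matrix, so `L` is a neighborhood of its value
(`range_lengthVector_mem_nhds`). The distance vector of `s` may lie on the boundary of the cone, but
the cone is convex with nonempty interior, so a nearby interior vector gives a generic flattenable
framework.

Conversely, a generic flattenable framework has a neighborhood `Ω` whose open projection lies in
`L`. The length map is piecewise polynomial, with one polynomial map for each pattern of signs of
the coordinate differences. Were all these finitely many maps algebraically dependent, the product
of their relations would vanish on an open set (`exists_algebraicIndependent`). So one map has
algebraically independent components, and by the Jacobian criterion its gradients, the rigidity rows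
up to the factor `p`, are independent at some point of its chamber.

If `G` is `d`-flattenable, any framework over the interior of the cone is generic and flattenable.
-/

noncomputable section

namespace LpFlattening

variable {V : Type*}

/-! ### Derivations and the Jacobian criterion -/

/-- In characteristic zero, a derivation that vanishes on a set vanishes on every element that is
algebraic over the subalgebra generated by the set. -/
theorem derivation_eq_zero_of_isAlgebraic {k A : Type*} [Field k] [CharZero k] [CommRing A]
    [IsDomain A] [Algebra k A] (D : Derivation k A A) {s : Set A} (hD : ∀ x ∈ s, D x = 0)
    {a : A} (ha : IsAlgebraic (Algebra.adjoin k s) a) : D a = 0 := by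
  have h0 : ∀ b : Algebra.adjoin k s, D b = 0 := fun b =>
    Derivation.eqOn_adjoin (D1 := D) (D2 := 0) (fun x hx => by simpa using hD x hx) b.2
  -- `D` kills the subalgebra, hence is linear over it.
  let D' : Derivation (Algebra.adjoin k s) A A := Derivation.mk'
    { toFun := D
      map_add' := D.map_add
      map_smul' := fun b x => by
        simp [Algebra.smul_def, D.leibniz, h0] }
    fun x y => D.leibniz x y
  have : CharZero (Algebra.adjoin k s) :=
    charZero_of_injective_algebraMap (algebraMap k (Algebra.adjoin k s)).injective
  have key : ∀ n : ℕ, ∀ P : Polynomial (Algebra.adjoin k s), P.natDegree = n → P ≠ 0 →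
      Polynomial.aeval a P = 0 → D a = 0 := by
    intro n
    induction n using Nat.strong_induction_on with
    | _ n ih =>
      intro P hn hP hPa
      -- Applying `D'` to `P(a) = 0` gives `P'(a) * D a = 0`; if `P'(a) = 0`, descend to the nonzero
      -- `P'` of smaller degree.
      have h1 : Polynomial.aeval a (Polynomial.derivative P) * D a = 0 := by
        have := D'.map_aeval P a
        rw [hPa, map_zero] at this
        exact this.symm
      rcases mul_eq_zero.1 h1 with h2 | h2
      · by_cases hd : P.natDegree = 0
        · rw [Polynomial.eq_C_of_natDegree_eq_zero hd] at hPa hP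
          rw [Polynomial.aeval_C] at hPa
          exact absurd (by rw [(FaithfulSMul.algebraMap_injective _ A) (hPa.trans (map_zero _).symm),
            map_zero]) hP
        · have hne : Polynomial.derivative P ≠ 0 := fun h =>
            hd (Polynomial.derivative_eq_zero.1 h)
          exact ih _ (hn ▸ Polynomial.natDegree_derivative_lt hd) _ rfl hne h2
      · exact h2
  obtain ⟨P, hP, hPa⟩ := ha
  exact key _ P rfl hP hPa

/-- The Jacobian criterion: the gradients of algebraically independent polynomials are linearly
independent at every point outside the zero set of some nonzero polynomial. -/
theorem exists_linearIndependent_pderiv {k ι σ : Type*} [Field k] [CharZero k] [Fintype σ]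
    {F : ι → MvPolynomial σ k} (hF : AlgebraicIndependent k F) :
    ∃ g : MvPolynomial σ k, g ≠ 0 ∧ ∀ x : σ → k, MvPolynomial.eval x g ≠ 0 →
      LinearIndependent k fun i j => MvPolynomial.eval x (MvPolynomial.pderiv j (F i)) := by
  classical
  -- Completing the family to a transcendence basis, which has as many elements as there are
  -- variables, makes the Jacobian square.
  obtain ⟨T, hFT, hT⟩ := exists_isTranscendenceBasis_superset hF.to_subtype_range
  have hcard := hT.lift_cardinalMk_eq (IsTranscendenceBasis.mvPolynomial σ k)
  have : Nonempty (σ ≃ T) := by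
    rw [eq_comm, Cardinal.lift_mk_eq'] at hcard
    exact hcard
  obtain ⟨e⟩ := this
  let J : Matrix σ σ (MvPolynomial σ k) := fun i j => MvPolynomial.pderiv j (e i : MvPolynomial σ k)
  have hJ : J.det ≠ 0 := by
    intro h
    obtain ⟨v, hv, hJv⟩ := Matrix.exists_mulVec_eq_zero_iff.2 h
    apply hv
    -- A kernel vector is a derivation killing the basis `T`, hence killing every variable, so `v =
    -- 0`.
    let D := MvPolynomial.mkDerivation k v
    have hDT : ∀ x ∈ T, D x = 0 := by
      intro x hx
      have := congrFun hJv (e.symm ⟨x, hx⟩)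
      simp only [J, Matrix.mulVec, dotProduct, Equiv.apply_symm_apply, Pi.zero_apply] at this
      rw [← this]
      have hsum (y : MvPolynomial σ k) : (∑ j, v j • MvPolynomial.pderiv j :
          Derivation k (MvPolynomial σ k) (MvPolynomial σ k)) y =
            ∑ j, v j * MvPolynomial.pderiv j y := by
        have := congrFun (map_sum (Derivation.coeFnAddMonoidHom (R := k)
          (A := MvPolynomial σ k) (M := MvPolynomial σ k))
          (fun j => v j • MvPolynomial.pderiv j) Finset.univ) y
        exact this.trans (Finset.sum_apply _ _ _)
      have hD : D = ∑ j, v j • MvPolynomial.pderiv j := by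
        apply MvPolynomial.derivation_ext
        intro i
        simp [D, MvPolynomial.mkDerivation_X, hsum, MvPolynomial.pderiv_X, Pi.single_apply]
      rw [hD, hsum]
      simp [mul_comm]
    funext i
    have hal := hT.isAlgebraic
    rw [Subtype.range_coe] at hal
    have := derivation_eq_zero_of_isAlgebraic D hDT (hal.isAlgebraic (MvPolynomial.X i))
    simpa [D, MvPolynomial.mkDerivation_X] using this
  refine ⟨J.det, hJ, fun x hx => ?_⟩
  have hdet : (J.map (MvPolynomial.eval x)).det ≠ 0 := by
    rwa [← RingHom.mapMatrix_apply, ← RingHom.map_det]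
  have hli := Matrix.linearIndependent_rows_of_det_ne_zero hdet
  let c : ι → σ := fun i => e.symm ⟨F i, hFT ⟨i, rfl⟩⟩
  have hc : Function.Injective c := fun i j h => hF.injective (by simpa [c] using h)
  have heq : (fun i j => MvPolynomial.eval x (MvPolynomial.pderiv j (F i))) =
      (fun i => J.map (MvPolynomial.eval x) i) ∘ c := by
    funext i j
    change _ = MvPolynomial.eval x (MvPolynomial.pderiv j (e (e.symm ⟨F i, hFT ⟨i, rfl⟩⟩)).1)
    rw [e.apply_symm_apply]
  rw [heq]
  exact hli.comp c hc

/-! ### Length vectors and flattenability -/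

@[simp]
theorem lengthVector_mk {p m : ℕ} (H : SimpleGraph V) (r : V → LpSpace p m) {v w : V}
    (h : s(v, w) ∈ H.edgeSet) :
    lengthVector H r ⟨s(v, w), h⟩ = ∑ k, |r v k - r w k| ^ p := rfl

theorem norm_pow_eq_sum {p m : ℕ} (hp : 1 ≤ p) (x : LpSpace p m) : ‖x‖ ^ p = ∑ k, |x k| ^ p := by
  have hp' : (0 : ℝ) < ((p : ℝ≥0∞)).toReal := by simp; omega
  rw [PiLp.norm_eq_sum hp', ← Real.rpow_natCast]
  have h0 : (0 : ℝ) ≤ ∑ i, ‖x i‖ ^ ((p : ℝ≥0∞)).toReal :=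
    Finset.sum_nonneg fun i _ => Real.rpow_nonneg (norm_nonneg _) _
  rw [← Real.rpow_mul h0, ENNReal.toReal_natCast, one_div_mul_cancel (by positivity), Real.rpow_one]
  simp [Real.rpow_natCast]

theorem norm_nonneg' {p m : ℕ} (hp : 1 ≤ p) (x : LpSpace p m) : 0 ≤ ‖x‖ := by
  have : Fact (1 ≤ (p : ℝ≥0∞)) := ⟨by exact_mod_cast hp⟩
  exact norm_nonneg x

theorem isFlattenableFramework_iff {p m d : ℕ} (hp : 1 ≤ p) (G : SimpleGraph V)
    (r : V → LpSpace p m) :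
    IsFlattenableFramework d G r ↔
      lengthVector G r ∈ Set.range (lengthVector (p := p) (m := d) G) := by
  have key (s : V → LpSpace p d) (v w : V) :
      ‖s v - s w‖ = ‖r v - r w‖ ↔ ∑ k, |s v k - s w k| ^ p = ∑ k, |r v k - r w k| ^ p := by
    rw [← pow_left_inj₀ (norm_nonneg' hp _) (norm_nonneg' hp _) (by omega : p ≠ 0),
      norm_pow_eq_sum hp, norm_pow_eq_sum hp]
    rfl
  constructor
  · rintro ⟨s, hs⟩
    refine ⟨s, ?_⟩
    funext ⟨e, he⟩
    induction e with
    | _ v w => exact (key s v w).1 (hs v w he)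
  · rintro ⟨s, hs⟩
    exact ⟨s, fun v w h => (key s v w).2 (congrFun hs ⟨s(v, w), h⟩)⟩

/-- The projection from pairwise distance vectors to edge length vectors. -/
def restrictEdges (G : SimpleGraph V) :
    ((⊤ : SimpleGraph V).edgeSet → ℝ) →L[ℝ] (G.edgeSet → ℝ) :=
  ContinuousLinearMap.pi fun e =>
    ContinuousLinearMap.proj ⟨e.1, SimpleGraph.edgeSet_mono (le_top : G ≤ ⊤) e.2⟩

theorem restrictEdges_lengthVector {p m : ℕ} (G : SimpleGraph V) (r : V → LpSpace p m) :
    restrictEdges G (lengthVector ⊤ r) = lengthVector G r := rfl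

theorem isOpenMap_restrictEdges [Finite V] (G : SimpleGraph V) : IsOpenMap (restrictEdges G) := by
  have := Fintype.ofFinite G.edgeSet
  have := Fintype.ofFinite (⊤ : SimpleGraph V).edgeSet
  refine ContinuousLinearMap.isOpenMap _ fun y => ?_
  classical
  refine ⟨fun e => if h : e.1 ∈ G.edgeSet then y ⟨e.1, h⟩ else 0, ?_⟩
  funext e
  simp [restrictEdges]

/-! ### Convexity and interior of the cone -/

theorem zero_mem_cone (p : ℕ) : 0 ∈ cone V p := by
  refine ⟨0, fun _ => 0, ?_⟩
  funext ⟨e, he⟩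
  induction e with
  | _ v w => simp

theorem smul_mem_cone {p : ℕ} (hp : 1 ≤ p) {c : ℝ} (hc : 0 ≤ c)
    {δ : (⊤ : SimpleGraph V).edgeSet → ℝ} (hδ : δ ∈ cone V p) : c • δ ∈ cone V p := by
  obtain ⟨m, r, rfl⟩ := hδ
  refine ⟨m, fun v => WithLp.toLp _ fun k => c ^ ((p : ℝ)⁻¹) * r v k, ?_⟩
  funext ⟨e, he⟩
  induction e with
  | _ v w =>
    simp only [lengthVector_mk, Pi.smul_apply, smul_eq_mul, Finset.mul_sum, ← mul_sub, abs_mul,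
      mul_pow]
    rw [abs_of_nonneg (Real.rpow_nonneg hc _), Real.rpow_inv_natCast_pow hc (by omega)]

theorem add_mem_cone {p : ℕ} {δ ε : (⊤ : SimpleGraph V).edgeSet → ℝ} (hδ : δ ∈ cone V p)
    (hε : ε ∈ cone V p) : δ + ε ∈ cone V p := by
  obtain ⟨m, r, rfl⟩ := hδ
  obtain ⟨n, s, rfl⟩ := hε
  -- Concatenating coordinates adds `p`-th powers of distances; here the arbitrary dimension is
  -- essential.
  refine ⟨m + n, fun v => WithLp.toLp _ (Fin.append (r v) (s v)), ?_⟩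
  funext ⟨e, he⟩
  induction e with
  | _ v w => simp [Fin.sum_univ_add]

theorem convex_cone {p : ℕ} (hp : 1 ≤ p) : Convex ℝ (cone V p) :=
  fun _ hx _ hy _ _ ha hb _ => add_mem_cone (smul_mem_cone hp ha hx) (smul_mem_cone hp hb hy)

/-- The cut vector of a vertex set. -/
theorem cut_mem_cone {p : ℕ} (hp : 1 ≤ p) (S : Set V) :
    ∃ δ ∈ cone V p, ∀ v w (h : s(v, w) ∈ (⊤ : SimpleGraph V).edgeSet),
      δ ⟨s(v, w), h⟩ = |S.indicator (1 : V → ℝ) v - S.indicator (1 : V → ℝ) w| := by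
  refine ⟨_, ⟨1, fun v => WithLp.toLp _ fun _ => S.indicator (1 : V → ℝ) v, rfl⟩, fun v w h => ?_⟩
  by_cases hv : v ∈ S <;> by_cases hw : w ∈ S <;>
    simp [hv, hw, zero_pow (by omega : p ≠ 0)]

/-- The unit vector of the pair `ab` is half of cut(`{a}`) + cut(`{b}`) - cut(`{a, b}`). -/
theorem span_cone [Finite V] {p : ℕ} (hp : 1 ≤ p) : Submodule.span ℝ (cone V p) = ⊤ := by
  classical
  have : Fintype V := Fintype.ofFinite V
  rw [eq_top_iff, ← (Pi.basisFun ℝ (⊤ : SimpleGraph V).edgeSet).span_eq, Submodule.span_le]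
  rintro _ ⟨⟨e, he⟩, rfl⟩
  induction e with
  | _ a b =>
    have hab : a ≠ b := by simpa using he
    obtain ⟨x, hx, hx'⟩ := cut_mem_cone (V := V) hp {a}
    obtain ⟨y, hy, hy'⟩ := cut_mem_cone (V := V) hp {b}
    obtain ⟨z, hz, hz'⟩ := cut_mem_cone (V := V) hp {a, b}
    have : Pi.basisFun ℝ (⊤ : SimpleGraph V).edgeSet ⟨s(a, b), he⟩ =
        (1 / 2 : ℝ) • (x + y - z) := by
      funext ⟨f, hf⟩
      induction f with
      | _ v w =>
        have hvw : v ≠ w := by simpa using hf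
        simp only [Pi.basisFun_apply, Pi.single_apply, Subtype.mk.injEq, Sym2.eq_iff, Pi.smul_apply,
          Pi.sub_apply, Pi.add_apply, hx', hy', hz', Set.indicator_apply, Set.mem_singleton_iff,
          Set.mem_insert_iff, Pi.one_apply, smul_eq_mul]
        by_cases h1 : v = a <;> by_cases h2 : v = b <;> by_cases h3 : w = a <;>
          by_cases h4 : w = b <;> simp_all <;> norm_num
    rw [this]
    exact Submodule.smul_mem _ _ (sub_mem (add_mem (Submodule.subset_span hx)
      (Submodule.subset_span hy)) (Submodule.subset_span hz))

theorem interior_cone_nonempty [Finite V] {p : ℕ} (hp : 1 ≤ p) :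
    (interior (cone V p)).Nonempty := by
  have : Fintype V := Fintype.ofFinite V
  classical
  rw [(convex_cone hp).interior_nonempty_iff_affineSpan_eq_top,
    ← Set.insert_eq_of_mem (zero_mem_cone p)]
  apply SetLike.coe_injective
  rw [affineSpan_insert_zero, span_cone hp]
  rfl

theorem mem_closure_interior_cone [Finite V] {p m : ℕ} (hp : 1 ≤ p) (r : V → LpSpace p m) :
    lengthVector ⊤ r ∈ closure (interior (cone V p)) := by
  rw [(convex_cone hp).closure_interior_eq_closure_of_nonempty_interior (interior_cone_nonempty hp)]
  exact subset_closure ⟨m, r, rfl⟩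

/-! ### The rigidity matrix and differentiability -/

/-- The function `x ↦ sgn x * |x| ^ (p - 1)`: the derivative of `|x| ^ p` divided by `p`. -/
def signPow (p : ℕ) (x : ℝ) : ℝ := Real.sign x * |x| ^ (p - 1)

theorem signPow_neg (p : ℕ) (x : ℝ) : signPow p (-x) = -signPow p x := by
  simp [signPow, Real.sign_neg]

theorem hasStrictDerivAt_abs_pow {p : ℕ} (hp : 1 ≤ p) {x : ℝ} (hx : p = 1 → x ≠ 0) :
    HasStrictDerivAt (fun y : ℝ => |y| ^ p) (p * signPow p x) x := by
  by_cases h : x = 0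
  · subst h
    have hp2 : (1 : ℝ) < p := by
      have : p ≠ 1 := fun h => hx h rfl
      exact_mod_cast (by omega : 1 < p)
    have h1 := (contDiff_norm_rpow (E := ℝ) hp2).contDiffAt (x := 0) |>.hasStrictDerivAt one_ne_zero
    rw [(hasDerivAt_norm_rpow 0 hp2).deriv] at h1
    simpa [signPow, Real.rpow_natCast] using h1
  · refine ((hasStrictDerivAt_abs h).fun_pow p).congr_deriv ?_
    rcases lt_or_gt_of_ne h with h | h
    · simp [signPow, Real.sign_of_neg h, sign_neg h]
    · simp [signPow, Real.sign_of_pos h, sign_pos h]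

theorem rigidityMatrix_mk [DecidableEq V] {p d : ℕ} (G : SimpleGraph V) (s : V → LpSpace p d)
    {a b : V} (h : s(a, b) ∈ G.edgeSet) (v : V) (k : Fin d) :
    rigidityMatrix G s ⟨s(a, b), h⟩ (v, k) =
      signPow p (s a k - s b k) * ((if v = a then 1 else 0) - if v = b then 1 else 0) := by
  have hab : a ≠ b := G.ne_of_adj h
  unfold rigidityMatrix
  split_ifs with hv hva hvb hvb hva hvb hvb
  · exact absurd (hva.symm.trans hvb) hab
  · have ho := Sym2.other_spec hv
    change s(v, _) = s(a, b) at ho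
    subst hva
    rw [Sym2.congr_right] at ho
    simp only [ho, signPow]
    ring
  · have ho := Sym2.other_spec hv
    change s(v, _) = s(a, b) at ho
    subst hvb
    rw [Sym2.eq_swap, Sym2.congr_left] at ho
    simp only [ho]
    change signPow p (s v k - s a k) = _
    rw [← neg_sub, signPow_neg]
    ring
  · exact absurd (Sym2.mem_iff.1 hv) (by simp [hva, hvb])
  · exact absurd (hva.symm.trans hvb) hab
  · exact absurd (Sym2.mem_iff.2 (Or.inl hva)) hv
  · exact absurd (Sym2.mem_iff.2 (Or.inr hvb)) hv
  · ring

/-- The two ends of an edge, in an arbitrary order. -/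
def ends {G : SimpleGraph V} (e : G.edgeSet) : V × V := Quot.out e.1

theorem mk_ends {G : SimpleGraph V} (e : G.edgeSet) : s((ends e).1, (ends e).2) = e.1 :=
  Quot.out_eq e.1

theorem adj_ends {G : SimpleGraph V} (e : G.edgeSet) : G.Adj (ends e).1 (ends e).2 := by
  rw [← SimpleGraph.mem_edgeSet, mk_ends]
  exact e.2

theorem lengthVector_apply {p m : ℕ} {G : SimpleGraph V} (r : V → LpSpace p m) (e : G.edgeSet) :
    lengthVector G r e = ∑ k, |r (ends e).1 k - r (ends e).2 k| ^ p := by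
  have h : e = ⟨s((ends e).1, (ends e).2), adj_ends e⟩ := Subtype.ext (mk_ends e).symm
  exact (congrArg (lengthVector G r) h).trans (lengthVector_mk G r (adj_ends e))

theorem rigidityMatrix_apply [DecidableEq V] {p d : ℕ} {G : SimpleGraph V} (s : V → LpSpace p d)
    (e : G.edgeSet) (v : V) (k : Fin d) :
    rigidityMatrix G s e (v, k) = signPow p (s (ends e).1 k - s (ends e).2 k) *
      ((if v = (ends e).1 then 1 else 0) - if v = (ends e).2 then 1 else 0) := by
  have h : e = ⟨s((ends e).1, (ends e).2), adj_ends e⟩ := Subtype.ext (mk_ends e).symm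
  exact (congrArg (fun e => rigidityMatrix G s e (v, k)) h).trans
    (rigidityMatrix_mk G s (adj_ends e) v k)

theorem rigidityMatrix_mulVec [Fintype V] {p d : ℕ} {G : SimpleGraph V} (s : V → LpSpace p d)
    (u : V × Fin d → ℝ) (e : G.edgeSet) :
    (rigidityMatrix G s).mulVec u e = ∑ k, signPow p (s (ends e).1 k - s (ends e).2 k) *
      (u ((ends e).1, k) - u ((ends e).2, k)) := by
  classical
  simp only [Matrix.mulVec, dotProduct, Fintype.sum_prod_type_right, rigidityMatrix_apply]
  refine Finset.sum_congr rfl fun k _ => ?_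
  simp only [mul_sub, sub_mul, Finset.sum_sub_distrib]
  simp

/-- The configuration with given coordinates. -/
def configuration (p : ℕ) {d : ℕ} (x : V × Fin d → ℝ) : V → LpSpace p d :=
  fun v => WithLp.toLp _ fun k => x (v, k)

@[simp]
theorem configuration_apply (p : ℕ) {d : ℕ} (x : V × Fin d → ℝ) (v : V) (k : Fin d) :
    configuration p x v k = x (v, k) := rfl

/-- If `x k = 0`, then along the `k`-th axis through `x` the `l_1` norm is `|t|` plus a constant. -/
theorem coordinate_ne_zero_of_differentiableAt_norm {d : ℕ} {x : LpSpace 1 d}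
    (hx : DifferentiableAt ℝ (fun y : LpSpace 1 d => ‖y‖) x) (k : Fin d) : x k ≠ 0 := by
  intro hk
  have : Fact (1 ≤ ((1 : ℕ) : ℝ≥0∞)) := ⟨by simp⟩
  have hline : DifferentiableAt ℝ
      (fun t : ℝ => x + t • (WithLp.toLp _ (Pi.single k 1) : LpSpace 1 d)) 0 := by fun_prop
  have h1 : DifferentiableAt ℝ
      (fun t : ℝ => ‖x + t • (WithLp.toLp _ (Pi.single k 1) : LpSpace 1 d)‖) 0 :=
    DifferentiableAt.comp (g := fun y : LpSpace 1 d => ‖y‖) (0 : ℝ) (by simpa using hx) hline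
  have h2 : (fun t : ℝ => ‖x + t • (WithLp.toLp _ (Pi.single k 1) : LpSpace 1 d)‖) =
      fun t => |t| + ∑ j ∈ Finset.univ.erase k, |x j| := by
    funext t
    rw [← pow_one (‖_‖), norm_pow_eq_sum le_rfl, ← Finset.add_sum_erase _ _ (Finset.mem_univ k)]
    congr 1
    · simp [hk]
    · refine Finset.sum_congr rfl fun j hj => ?_
      simp [Finset.ne_of_mem_erase hj]
  rw [h2] at h1
  exact not_differentiableAt_abs_zero (by simpa using h1)

theorem differentiableAt_norm {p d : ℕ} (hp : 1 ≤ p) {x : LpSpace p d} (hx : ∀ k, x k ≠ 0) :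
    DifferentiableAt ℝ (fun y : LpSpace p d => ‖y‖) x := by
  have : Fact (1 ≤ (p : ℝ≥0∞)) := ⟨by exact_mod_cast hp⟩
  have hnorm : (fun y : LpSpace p d => ‖y‖) = fun y => (∑ k, |y k| ^ p) ^ ((p : ℝ)⁻¹) := by
    funext y
    rw [← norm_pow_eq_sum hp, Real.pow_rpow_inv_natCast (norm_nonneg _) (by omega)]
  rw [hnorm]
  rcases Nat.eq_zero_or_pos d with rfl | hd
  · simp
  · refine DifferentiableAt.rpow_const (DifferentiableAt.fun_sum fun k _ => ?_) (Or.inl ?_)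
    · have h1 := (hasStrictDerivAt_abs_pow hp (x := x k) fun _ => hx k).hasDerivAt.differentiableAt
      have h2 : DifferentiableAt ℝ (fun y : LpSpace p d => y k) x := by fun_prop
      exact DifferentiableAt.comp (g := fun t : ℝ => |t| ^ p) x h1 h2
    · have : Nonempty (Fin d) := ⟨⟨0, hd⟩⟩
      exact (Finset.sum_pos (fun k _ => pow_pos (abs_pos.2 (hx k)) p) Finset.univ_nonempty).ne'

/-! ### Independence makes the length map locally open -/

theorem range_lengthVector_mem_nhds [Fintype V] {p d : ℕ} (hp : 1 ≤ p) {G : SimpleGraph V}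
    {s : V → LpSpace p d} (hs : IsWellPositioned G s)
    (hli : LinearIndependent ℝ (rigidityMatrix G s).row) :
    Set.range (lengthVector (p := p) (m := d) G) ∈ nhds (lengthVector G s) := by
  classical
  have := Fintype.ofFinite G.edgeSet
  let f : (V × Fin d → ℝ) → G.edgeSet → ℝ := fun x e =>
    ∑ k, |x ((ends e).1, k) - x ((ends e).2, k)| ^ p
  have hf (x) : f x = lengthVector G (configuration p x) := by
    funext e
    rw [lengthVector_apply]
    rfl
  let π (c : V × Fin d) : (V × Fin d → ℝ) →L[ℝ] ℝ := ContinuousLinearMap.proj c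
  let f' : (V × Fin d → ℝ) →L[ℝ] (G.edgeSet → ℝ) := ContinuousLinearMap.pi fun e =>
    ∑ k, ((p : ℝ) * signPow p (s (ends e).1 k - s (ends e).2 k)) •
      (π ((ends e).1, k) - π ((ends e).2, k))
  -- For `p ≥ 2`, `|y| ^ p` is differentiable even at `0`; only `p = 1` needs well-positionedness.
  have hne (e : G.edgeSet) (k : Fin d) (h1 : p = 1) : s (ends e).1 k - s (ends e).2 k ≠ 0 := by
    subst h1
    exact coordinate_ne_zero_of_differentiableAt_norm (hs _ _ (adj_ends e)) k
  have hderiv : HasStrictFDerivAt f f' (fun c => s c.1 c.2) := by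
    refine hasStrictFDerivAt_pi.2 fun e => HasStrictFDerivAt.fun_sum fun k _ => ?_
    have hsub : HasStrictFDerivAt
        (fun x : V × Fin d → ℝ => x ((ends e).1, k) - x ((ends e).2, k))
        (π ((ends e).1, k) - π ((ends e).2, k)) (fun c => s c.1 c.2) := 
          (π ((ends e).1, k) - π ((ends e).2, k)).hasStrictFDerivAt
    exact (hasStrictDerivAt_abs_pow hp (hne e k)).comp_hasStrictFDerivAt
      (f := fun x : V × Fin d → ℝ => x ((ends e).1, k) - x ((ends e).2, k))
      (fun c => s c.1 c.2) hsub
  have hp0 : (p : ℝ) ≠ 0 := by positivity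
  have hf' (u : V × Fin d → ℝ) : f' u = (p : ℝ) • (rigidityMatrix G s).mulVec u := by
    funext e
    simp [f', π, rigidityMatrix_mulVec, Finset.mul_sum, mul_assoc]
  have hR : LinearMap.range (rigidityMatrix G s).mulVecLin = ⊤ := by
    apply Submodule.eq_top_of_finrank_eq
    rw [Module.finrank_fintype_fun_eq_card]
    exact hli.rank_matrix
  have hrange : LinearMap.range (f' : (V × Fin d → ℝ) →ₗ[ℝ] (G.edgeSet → ℝ)) = ⊤ := by
    rw [LinearMap.range_eq_top] at hR ⊢
    intro y
    obtain ⟨u, hu⟩ := hR ((p : ℝ)⁻¹ • y)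
    refine ⟨u, ?_⟩
    rw [Matrix.mulVecLin_apply] at hu
    rw [ContinuousLinearMap.coe_coe, hf', hu, smul_inv_smul₀ hp0]
  have hmap := hderiv.map_nhds_eq_of_surj hrange
  rw [show f (fun c => s c.1 c.2) = lengthVector G s from
    hf fun c : V × Fin d => s c.1 c.2] at hmap
  rw [← hmap]
  refine Filter.mem_map.2 (Filter.univ_mem' fun x => ?_)
  exact ⟨configuration p x, (hf x).symm⟩

/-- Independent rows give rank equal to the number of edges, which no framework can exceed. -/
theorem IsIndependent.of_linearIndependent [Fintype V] {p d : ℕ} {G : SimpleGraph V}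
    {s : V → LpSpace p d} (hs : IsWellPositioned G s)
    (hli : LinearIndependent ℝ (rigidityMatrix G s).row) : IsIndependent p d G := by
  classical
  have := Fintype.ofFinite G.edgeSet
  refine ⟨s, ⟨hs, fun t _ => ?_⟩, hli⟩
  rw [hli.rank_matrix]
  exact Matrix.rank_le_card_height _

/-! ### Polynomial maps covering an open set -/

theorem exists_mem_eval_ne_zero {ι : Type*} [Finite ι] {g : MvPolynomial ι ℝ} (hg : g ≠ 0)
    {U : Set (ι → ℝ)} (hU : IsOpen U) (hne : U.Nonempty) :
    ∃ x ∈ U, MvPolynomial.eval x g ≠ 0 := by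
  have := Fintype.ofFinite ι
  by_contra! h
  obtain ⟨x, hx⟩ := hne
  obtain ⟨r, hr, hball⟩ := Metric.isOpen_iff.1 hU x hx
  refine hg (MvPolynomial.funext_set (fun i => Metric.ball (x i) r) (fun i => ?_) fun y hy => ?_)
  · rw [Real.ball_eq_Ioo]
    exact Set.Ioo_infinite (by linarith)
  · rw [map_zero]
    exact h y (hball (by rwa [ball_pi _ hr]))

theorem eval_aeval {k ι σ : Type*} [CommSemiring k] (F : ι → MvPolynomial σ k) (x : σ → k)
    (P : MvPolynomial ι k) : MvPolynomial.eval x (MvPolynomial.aeval F P) =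
      MvPolynomial.eval (fun i => MvPolynomial.eval x (F i)) P := by
  induction P using MvPolynomial.induction_on with
  | C a => simp
  | add P Q hP hQ => simp only [map_add, hP, hQ]
  | mul_X P i hP => simp only [map_mul, hP, MvPolynomial.aeval_X, MvPolynomial.eval_X]

/-- If an open set is covered by the images of finitely many polynomial maps, then the components of
one of these maps are algebraically independent. -/
theorem exists_algebraicIndependent {α ι σ : Type*} [Finite α] [Finite ι]
    (F : α → ι → MvPolynomial σ ℝ) {U : Set (ι → ℝ)} (hU : IsOpen U) (hne : U.Nonempty)
    (hsub : ∀ y ∈ U, ∃ a x, y = fun i => MvPolynomial.eval x (F a i)) :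
    ∃ a, AlgebraicIndependent ℝ (F a) := by
  have := Fintype.ofFinite α
  by_contra! hdep
  have hrel (a : α) : ∃ P : MvPolynomial ι ℝ, MvPolynomial.aeval (F a) P = 0 ∧ P ≠ 0 := by
    have := hdep a
    rw [algebraicIndependent_iff] at this
    push Not at this
    exact this
  choose P hP hP0 using hrel
  obtain ⟨y, hy, hy0⟩ := exists_mem_eval_ne_zero
    (Finset.prod_ne_zero_iff.2 fun a (_ : a ∈ Finset.univ) => hP0 a) hU hne
  rw [map_prod, Finset.prod_ne_zero_iff] at hy0
  obtain ⟨a, x, rfl⟩ := hsub y hy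
  apply hy0 a (Finset.mem_univ a)
  rw [← eval_aeval, hP a, map_zero]

/-! ### Sign chambers and polynomial edge lengths -/

/-- The chamber of the configurations for which the differences of the coordinates of the ends of
the edges have the given signs. -/
def chamber {d : ℕ} {G : SimpleGraph V} (ε : G.edgeSet → Fin d → ℤˣ) : Set (V × Fin d → ℝ) :=
  {x | ∀ e k, 0 < ((ε e k : ℤ) : ℝ) * (x ((ends e).1, k) - x ((ends e).2, k))}

theorem isOpen_chamber [Finite V] {d : ℕ} {G : SimpleGraph V} (ε : G.edgeSet → Fin d → ℤˣ) :
    IsOpen (chamber ε) := by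
  simp only [chamber, Set.ofPred_forall]
  exact isOpen_iInter_of_finite fun e => isOpen_iInter_of_finite fun k =>
    isOpen_lt continuous_const (by fun_prop)

/-- Moving `x` slightly in a direction `u` that separates all vertices makes every edge difference
nonzero: nonzero differences keep their sign, and zero ones take that of `u`. -/
theorem exists_chamber [Finite V] {d : ℕ} (G : SimpleGraph V) (x : V × Fin d → ℝ) :
    ∃ ε : G.edgeSet → Fin d → ℤˣ, (chamber ε).Nonempty ∧
      ∀ e k, 0 ≤ ((ε e k : ℤ) : ℝ) * (x ((ends e).1, k) - x ((ends e).2, k)) := by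
  obtain ⟨n, ⟨φ⟩⟩ := Finite.exists_equiv_fin V
  let u : V → ℝ := fun v => (φ v : ℕ)
  have hu : Function.Injective u := fun v w h => by simpa [u, Fin.val_inj] using h
  have hlim (e : G.edgeSet) (k : Fin d) : ∃ ε : ℤˣ,
      0 ≤ ((ε : ℤ) : ℝ) * (x ((ends e).1, k) - x ((ends e).2, k)) ∧
      ∀ᶠ t : ℝ in nhdsWithin 0 (Set.Ioi 0), 0 < ((ε : ℤ) : ℝ) *
        ((x ((ends e).1, k) + t * u (ends e).1) - (x ((ends e).2, k) + t * u (ends e).2)) := by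
    have hne : u (ends e).1 - u (ends e).2 ≠ 0 := sub_ne_zero.2 (hu.ne (adj_ends e).ne)
    have hsign (y : ℝ) (hy : y ≠ 0) : ∃ ε : ℤˣ, 0 < ((ε : ℤ) : ℝ) * y := by
      rcases lt_or_gt_of_ne hy with h | h
      · exact ⟨-1, by simpa using h⟩
      · exact ⟨1, by simpa using h⟩
    by_cases h : x ((ends e).1, k) - x ((ends e).2, k) = 0
    · obtain ⟨ε, hε⟩ := hsign _ hne
      refine ⟨ε, by simp [h], Filter.eventually_of_mem self_mem_nhdsWithin fun t ht => ?_⟩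
      rw [Set.mem_Ioi] at ht
      have : ((ε : ℤ) : ℝ) *
          ((x ((ends e).1, k) + t * u (ends e).1) - (x ((ends e).2, k) + t * u (ends e).2)) =
          t * (((ε : ℤ) : ℝ) * (u (ends e).1 - u (ends e).2)) := by
        linear_combination ((ε : ℤ) : ℝ) * h
      rw [this]
      positivity
    · obtain ⟨ε, hε⟩ := hsign _ h
      refine ⟨ε, hε.le, nhdsWithin_le_nhds ?_⟩
      refine ContinuousAt.eventually_lt (f := fun _ => (0 : ℝ)) continuousAt_const
        (Continuous.continuousAt (by fun_prop)) ?_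
      simpa using hε
  choose ε hε hev using hlim
  obtain ⟨t, ht⟩ := (Filter.eventually_all.2 fun e => Filter.eventually_all.2 (hev e)).exists
  exact ⟨ε, ⟨fun c => x c + t * u c.1, ht⟩, hε⟩

/-- The polynomial that gives the `l_p^p` edge lengths on a chamber. -/
def edgePolynomial (p : ℕ) {d : ℕ} {G : SimpleGraph V} (ε : G.edgeSet → Fin d → ℤˣ)
    (e : G.edgeSet) : MvPolynomial (V × Fin d) ℝ :=
  ∑ k, (MvPolynomial.C ((ε e k : ℤ) : ℝ) *
    (MvPolynomial.X ((ends e).1, k) - MvPolynomial.X ((ends e).2, k))) ^ p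

theorem eval_edgePolynomial (p : ℕ) {d : ℕ} {G : SimpleGraph V} {ε : G.edgeSet → Fin d → ℤˣ}
    {x : V × Fin d → ℝ}
    (hx : ∀ e k, 0 ≤ ((ε e k : ℤ) : ℝ) * (x ((ends e).1, k) - x ((ends e).2, k)))
    (e : G.edgeSet) :
    MvPolynomial.eval x (edgePolynomial p ε e) = lengthVector G (configuration p x) e := by
  rw [lengthVector_apply]
  simp only [edgePolynomial, map_sum, map_pow, map_mul, map_sub, MvPolynomial.eval_C,
    MvPolynomial.eval_X, configuration_apply]
  refine Finset.sum_congr rfl fun k _ => ?_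
  rw [← abs_of_nonneg (hx e k), abs_mul]
  rcases Int.units_eq_one_or (ε e k) with h | h <;> simp [h]

/-- Only patterns with nonempty chamber are kept, since a point with independent gradients must
later be found inside the chamber. -/
theorem exists_eval_edgePolynomial [Finite V] {p d : ℕ} {G : SimpleGraph V} {y : G.edgeSet → ℝ}
    (hy : y ∈ Set.range (lengthVector (p := p) (m := d) G)) :
    ∃ (ε : {ε : G.edgeSet → Fin d → ℤˣ // (chamber ε).Nonempty}) (x : V × Fin d → ℝ),
      y = fun e => MvPolynomial.eval x (edgePolynomial p ε.1 e) := by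
  obtain ⟨s, hs⟩ := hy
  obtain ⟨ε, hε, hx⟩ := exists_chamber G fun c : V × Fin d => s c.1 c.2
  refine ⟨⟨ε, hε⟩, fun c => s c.1 c.2, funext fun e => ?_⟩
  rw [← hs, eval_edgePolynomial p hx]
  rfl

theorem eval_pderiv_edgePolynomial [Finite V] (p : ℕ) {d : ℕ} {G : SimpleGraph V}
    {ε : G.edgeSet → Fin d → ℤˣ} {x : V × Fin d → ℝ} (hx : x ∈ chamber ε)
    (e : G.edgeSet) (c : V × Fin d) :
    MvPolynomial.eval x (MvPolynomial.pderiv c (edgePolynomial p ε e)) =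
      p * rigidityMatrix G (configuration p x) e c := by
  classical
  obtain ⟨v, k⟩ := c
  have hterm (l : Fin d) : MvPolynomial.eval x (MvPolynomial.pderiv (v, k)
      ((MvPolynomial.C ((ε e l : ℤ) : ℝ) *
        (MvPolynomial.X ((ends e).1, l) - MvPolynomial.X ((ends e).2, l))) ^ p)) =
      if l = k then (p : ℝ) * (signPow p (x ((ends e).1, l) - x ((ends e).2, l)) *
        ((if v = (ends e).1 then 1 else 0) - if v = (ends e).2 then 1 else 0)) else 0 := by
    -- In the chamber `ε e l` is the sign of the difference, and their product its absolute value.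
    have hs : signPow p (x ((ends e).1, l) - x ((ends e).2, l)) = ((ε e l : ℤ) : ℝ) *
        (((ε e l : ℤ) : ℝ) * (x ((ends e).1, l) - x ((ends e).2, l))) ^ (p - 1) := by
      have h0 := hx e l
      rcases Int.units_eq_one_or (ε e l) with h | h
      · simp only [h, Units.val_one, Int.cast_one, one_mul] at h0 ⊢
        simp [signPow, Real.sign_of_pos h0, abs_of_pos h0]
      · have h1 : x ((ends e).1, l) - x ((ends e).2, l) < 0 := by simpa [h] using h0
        simp [h, signPow, Real.sign_of_neg h1, abs_of_neg h1]
    rw [hs, Derivation.leibniz_pow, Derivation.leibniz]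
    by_cases hl : l = k
    · subst hl
      simp only [eq_comm (a := v)]
      by_cases h1 : (ends e).1 = v <;> by_cases h2 : (ends e).2 = v <;>
        simp [MvPolynomial.pderiv_X, h1, h2, mul_comm, mul_left_comm]
    · simp [MvPolynomial.pderiv_X, hl]
  rw [rigidityMatrix_apply, edgePolynomial, map_sum, map_sum, Finset.sum_congr rfl fun l _ => hterm l]
  simp

theorem exists_linearIndependent_rigidityMatrix [Fintype V] {p d : ℕ} (hp : 1 ≤ p)
    {G : SimpleGraph V} {U : Set (G.edgeSet → ℝ)} (hU : IsOpen U) (hne : U.Nonempty)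
    (hsub : U ⊆ Set.range (lengthVector (p := p) (m := d) G)) :
    ∃ s : V → LpSpace p d, IsWellPositioned G s ∧
      LinearIndependent ℝ (rigidityMatrix G s).row := by
  classical
  have := Fintype.ofFinite G.edgeSet
  have hind : ∃ ε : G.edgeSet → Fin d → ℤˣ,
      (chamber ε).Nonempty ∧ AlgebraicIndependent ℝ (edgePolynomial p ε) := by
    obtain ⟨ε, hε⟩ := exists_algebraicIndependent
      (fun ε : {ε : G.edgeSet → Fin d → ℤˣ // (chamber ε).Nonempty} => edgePolynomial p ε.1)
      hU hne fun y hy => exists_eval_edgePolynomial (hsub hy)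
    exact ⟨ε.1, ε.2, hε⟩
  obtain ⟨ε, hε, hF⟩ := hind
  obtain ⟨g, hg, hli⟩ := exists_linearIndependent_pderiv hF
  obtain ⟨x, hx, hgx⟩ := exists_mem_eval_ne_zero hg (isOpen_chamber ε) hε
  refine ⟨configuration p x, fun v w h => differentiableAt_norm hp fun k => ?_, ?_⟩
  · have hne := right_ne_zero_of_mul (hx ⟨s(v, w), h⟩ k).ne'
    have hends := mk_ends (G := G) ⟨s(v, w), h⟩
    rw [Sym2.eq_iff] at hends
    rcases hends with ⟨h1, h2⟩ | ⟨h1, h2⟩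
    · rw [h1, h2] at hne
      exact hne
    · rw [h1, h2] at hne
      rw [← neg_sub, neg_ne_zero] at hne
      exact hne
  · have hp0 : (p : ℝ)⁻¹ ≠ 0 := by positivity
    have heq : (rigidityMatrix G (configuration p x)).row =
        (fun _ : G.edgeSet => Units.mk0 _ hp0) • fun e c =>
          MvPolynomial.eval x (MvPolynomial.pderiv c (edgePolynomial p ε e)) := by
      funext e c
      simp only [Pi.smul_apply', Pi.smul_apply, Units.smul_mk0, eval_pderiv_edgePolynomial p hx,
        smul_eq_mul, Matrix.row]
      rw [inv_mul_cancel_left₀ (by positivity)]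
    rw [heq]
    exact (hli x hgx).units_smul _

/-! ### The two directions and flattenable graphs -/

theorem IsIndependent.of_isGeneric [Fintype V] {p m d : ℕ} (hp : 1 ≤ p) {G : SimpleGraph V}
    {r : V → LpSpace p m} (hr : IsGeneric d G r) (hflat : IsFlattenableFramework d G r) :
    IsIndependent p d G := by
  obtain ⟨Ω, hΩ, hrΩ, hsub, hiff⟩ := hr
  have hall := hiff.1 hflat
  obtain ⟨s, hs, hli⟩ := exists_linearIndependent_rigidityMatrix (d := d) hp
    (isOpenMap_restrictEdges G Ω hΩ) (Set.Nonempty.image _ ⟨_, hrΩ⟩) (by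
      rintro _ ⟨δ, hδ, rfl⟩
      obtain ⟨m', r', rfl⟩ := interior_subset (hsub hδ)
      rw [restrictEdges_lengthVector]
      exact (isFlattenableFramework_iff hp G r').1 (hall m' r' hδ))
  exact .of_linearIndependent hs hli

theorem IsIndependent.exists_isGeneric [Fintype V] {p d : ℕ} (hp : 1 ≤ p) {G : SimpleGraph V}
    (h : IsIndependent p d G) :
    ∃ (m : ℕ) (r : V → LpSpace p m), IsGeneric d G r ∧ IsFlattenableFramework d G r := by
  obtain ⟨s, ⟨hs, -⟩, hli⟩ := h
  obtain ⟨W, hW, hWo, hsW⟩ := mem_nhds_iff.1 (range_lengthVector_mem_nhds hp hs hli)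
  have hpre : IsOpen (restrictEdges G ⁻¹' W) := hWo.preimage (restrictEdges G).continuous
  -- The new framework may need a larger dimension, but its edge lengths stay in `W`, hence are
  -- realized in dimension `d`.
  obtain ⟨δ, hδW, hδ⟩ := mem_closure_iff.1 (mem_closure_interior_cone hp s) _ hpre
    (by rwa [Set.mem_preimage, restrictEdges_lengthVector])
  obtain ⟨m, r, rfl⟩ := interior_subset hδ
  have hflat (m' : ℕ) (r' : V → LpSpace p m') (h : lengthVector ⊤ r' ∈ restrictEdges G ⁻¹' W) :
      IsFlattenableFramework d G r' :=
    (isFlattenableFramework_iff hp G r').2 (hW h)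
  exact ⟨m, r, ⟨interior (cone V p) ∩ restrictEdges G ⁻¹' W, isOpen_interior.inter hpre,
    ⟨hδ, hδW⟩, Set.inter_subset_left, fun _ m' r' h => hflat m' r' h.2, fun _ => hflat m r hδW⟩,
    hflat m r hδW⟩

theorem IsFlattenable.isIndependent [Fintype V] {p d : ℕ} (hp : 1 ≤ p) {G : SimpleGraph V}
    (h : IsFlattenable p d G) : IsIndependent p d G := by
  obtain ⟨δ, hδ⟩ := interior_cone_nonempty (V := V) hp
  obtain ⟨m, r, rfl⟩ := interior_subset hδ
  exact .of_isGeneric hp ⟨interior (cone V p), isOpen_interior, hδ, subset_rfl,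
    fun _ m' r' _ => h m' r', fun _ => h m r⟩ (h m r)

end LpFlattening

end

theorem mainTheorem2 {V : Type*} [Fintype V] (G : SimpleGraph V) (p : ℕ) (hp : 1 ≤ p) (d : ℕ) :
    ((∃ (m : ℕ) (r : V → LpFlattening.LpSpace p m),
        LpFlattening.IsGeneric d G r ∧ LpFlattening.IsFlattenableFramework d G r) ↔
      LpFlattening.IsIndependent p d G) ∧
    (LpFlattening.IsFlattenable p d G → LpFlattening.IsIndependent p d G) := by
  exact ⟨⟨fun ⟨_, _, hgen, hflat⟩ => .of_isGeneric hp hgen hflat,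
    fun h => h.exists_isGeneric hp⟩, fun h => h.isIndependent hp⟩
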